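/- Let $\Xi$ be a finite oriented graph (loops and multiple edges allowed) with vertex set $V(\Xi)$, edge set $E(\Xi)$ and endpoint maps $d_0,d_1\colon E(\Xi)\to V(\Xi)$, and let $\Theta$ be a spanning tree of $\Xi$. A graph of profinite groups $(\mathcal G,\Xi)$ consists of profinite groups $\mathcal G(x)$ for all vertices and edges $x$ of $\Xi$ and continuous injective homomorphisms $\partial_i\colon\mathcal G(e)\to\mathcal G(d_i(e))$ for $e\in E(\Xi)$, $i=0,1$. Its profinite fundamental group $\Pi_1(\mathcal G,\Xi,\Theta)$ is the quotient $W/N$, where $W$ is the free profinite product of the vertex groups $\mathcal G(v)$ and of the free profinite group on letters $t_e$ ($e\in E(\Xi)$), and $N$ is the closed normal subgroup of $W$ generated by the elements $t_e$ for $e\in E(\Theta)$ and $\partial_1(g)\,t_e^{-1}\,\partial_0(g)^{-1}\,t_e$ for $e\in E(\Xi)$, $g\in\mathcal G(e)$. A profinite group is strongly complete if all its normal subgroups of finite index are open. A closed subgroup $H$ of a profinite group $G$ is accessible within $G$ via $(\mathcal G,\Xi,\Theta)$ if all edge groups are finite, all vertex groups are strongly complete, and there is an isomorphism of topological groups $G\cong\Pi_1(\mathcal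 G,\Xi,\Theta)$ under which $H$ is the image of the vertex group $\mathcal G(v)$ for some vertex $v$. For a finite (unital, not necessarily commutative) ring $R$, let $R[[G]]=\varprojlim_U R[G/U]$ be the completed group algebra, where $U$ runs over the open normal subgroups of $G$, each $R[G/U]$ is discrete, and $G$ acts by right multiplication. A right derivation of $G$ in a right $G$-module $M$ is a map $f\colon G\to M$ with $f(gh)=f(g)h+f(h)$ for all $g,h\in G$; write $\operatorname{Ker}(f)=\{g\in G: f(g)=0\}$. **Theorem.** Let $G$ be a profinite group and let $H\le G$ be a closed subgroup which is accessible within $G$ via a graph of profinite groups $(\mathcal G,\Xi,\Theta)$, where the finite graph $\Xi$ has $n$ edges. Let $R$ be a finite ring such that the image of the integer $|\mathcal G(e)|$ in $R$ is non-zero for every $e\in E(\Xi)$. Then there is a continuous right derivation $f\colon G\to R[[G]]^n$ with $\operatorname{Ker}(f)=H$. -/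

import Mathlib

/-! ## Finite oriented graphs and spanning trees -/

/-- An oriented graph with vertex set `V` and edge set `E`; loops and multiple edges are allowed.
`d₀ e` is the initial and `d₁ e` the terminal vertex of the edge `e`. -/
structure OrientedGraph (V E : Type*) where
  d₀ : E → V
  d₁ : E → V

namespace OrientedGraph

variable {V E : Type*} (Ξ : OrientedGraph V E)

/-- Two vertices are joined by an (unoriented) path all of whose edges lie in `A`. -/
def Joined (A : Set E) : V → V → Prop :=
  Relation.EqvGen fun a b => ∃ e ∈ A, Ξ.d₀ e = a ∧ Ξ.d₁ e = b

/-- The set of edges `Θ`, together with all vertices of `Ξ`, forms a spanning tree of `Ξ`: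
it is non-empty and connected, and it has no circuits, i.e. the removal of any edge of `Θ`
separates the two endpoints of that edge. (In particular `Ξ` itself is connected.) -/
structure IsSpanningTree (Θ : Set E) : Prop where
  nonempty : Nonempty V
  connected : ∀ v w, Ξ.Joined Θ v w
  acyclic : ∀ e ∈ Θ, ¬ Ξ.Joined (Θ \ {e}) (Ξ.d₀ e) (Ξ.d₁ e)

end OrientedGraph

/-! ## Graphs of profinite groups -/

universe uV uE uX uY

set_option linter.checkUnivs false in
/-- A graph of profinite groups over the oriented graph `Ξ`: profinite vertex and edge groups,
and continuous injective edge inclusions into the groups of the two endpoints. -/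
structure GraphOfProfiniteGroups {V : Type uV} {E : Type uE} (Ξ : OrientedGraph V E) where
  vertexGroup : V → ProfiniteGrp.{uX}
  edgeGroup : E → ProfiniteGrp.{uY}
  bd₀ : ∀ e, edgeGroup e →ₜ* vertexGroup (Ξ.d₀ e)
  bd₁ : ∀ e, edgeGroup e →ₜ* vertexGroup (Ξ.d₁ e)
  bd₀_injective : ∀ e, Function.Injective (bd₀ e)
  bd₁_injective : ∀ e, Function.Injective (bd₁ e)

namespace GraphOfProfiniteGroups

variable {V : Type uV} {E : Type uE} {Ξ : OrientedGraph V E}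
  (𝒢 : GraphOfProfiniteGroups.{uV, uE, uX, uY} Ξ)

/-- The abstract free product of all vertex groups and of the free group on the stable letters
`t_e`, one for each edge `e`. -/
abbrev AbstractFreeProduct : Type _ :=
  Monoid.Coprod (Monoid.CoprodI fun v => 𝒢.vertexGroup v) (FreeGroup E)

/-- The inclusion of a vertex group in the abstract free product. -/
def abstractVertex (v : V) : 𝒢.vertexGroup v →* 𝒢.AbstractFreeProduct :=
  Monoid.Coprod.inl.comp (Monoid.CoprodI.of (M := fun v => 𝒢.vertexGroup v) (i := v))

/-- The stable letter `t_e` in the abstract free product. -/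
def abstractLetter (e : E) : 𝒢.AbstractFreeProduct :=
  Monoid.Coprod.inr (FreeGroup.of e)

/-- The normal subgroups of finite index of the abstract free product which meet each vertex
group in an open subgroup. They are the kernels of the homomorphisms to finite groups whose
restrictions to the vertex groups are continuous. -/
structure AdmissibleSubgroup where
  toSubgroup : Subgroup 𝒢.AbstractFreeProduct
  normal : toSubgroup.Normal
  finiteIndex : toSubgroup.FiniteIndex
  isOpen_comap : ∀ v, IsOpen (toSubgroup.comap (𝒢.abstractVertex v) : Set (𝒢.vertexGroup v))

attribute [instance] AdmissibleSubgroup.normal AdmissibleSubgroup.finiteIndex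

/-- The finite quotient of the abstract free product by an admissible subgroup. -/
def FiniteQuotient (N : 𝒢.AdmissibleSubgroup) : Type _ :=
  𝒢.AbstractFreeProduct ⧸ N.toSubgroup

instance (N : 𝒢.AdmissibleSubgroup) : Group (𝒢.FiniteQuotient N) :=
  inferInstanceAs (Group (𝒢.AbstractFreeProduct ⧸ N.toSubgroup))

/-- The finite quotients are discrete. -/
instance (N : 𝒢.AdmissibleSubgroup) : TopologicalSpace (𝒢.FiniteQuotient N) := ⊥

instance (N : 𝒢.AdmissibleSubgroup) : DiscreteTopology (𝒢.FiniteQuotient N) := ⟨rfl⟩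

/-- The diagonal map from the abstract free product to the product of its finite quotients by
admissible subgroups. -/
def diagonal : 𝒢.AbstractFreeProduct →* ∀ N : 𝒢.AdmissibleSubgroup, 𝒢.FiniteQuotient N :=
  MonoidHom.pi fun N => QuotientGroup.mk' N.toSubgroup

/-- The profinite group `W(𝒢, Ξ)`: the free profinite product of the vertex groups and of the free
profinite group on the set of stable letters. It is the completion of the abstract free product
with respect to the admissible subgroups, i.e. the closure of its image in the product of the
(discrete) finite quotients. -/
def freeProfiniteProduct : Subgroup (∀ N : 𝒢.AdmissibleSubgroup, 𝒢.FiniteQuotient N) :=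
  𝒢.diagonal.range.topologicalClosure

/-- The canonical map from the abstract free product to `W(𝒢, Ξ)`. -/
def toFreeProfiniteProduct : 𝒢.AbstractFreeProduct →* 𝒢.freeProfiniteProduct :=
  𝒢.diagonal.codRestrict _ fun x => Subgroup.le_topologicalClosure _ ⟨x, rfl⟩

/-- The canonical map from a vertex group to `W(𝒢, Ξ)`. -/
def vertexToFree (v : V) : 𝒢.vertexGroup v →* 𝒢.freeProfiniteProduct :=
  𝒢.toFreeProfiniteProduct.comp (𝒢.abstractVertex v)

/-- The stable letter `t_e` in `W(𝒢, Ξ)`. -/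
def letterInFree (e : E) : 𝒢.freeProfiniteProduct :=
  𝒢.toFreeProfiniteProduct (𝒢.abstractLetter e)

/-- The defining relators: `t_e` for `e ∈ Θ`, and `∂₁(g) t_e⁻¹ ∂₀(g)⁻¹ t_e` for every edge `e` and
`g` in its edge group. -/
def relators (Θ : Set E) : Set 𝒢.freeProfiniteProduct :=
  {x | ∃ e ∈ Θ, x = 𝒢.letterInFree e} ∪
  {x | ∃ (e : E) (g : 𝒢.edgeGroup e),
    x = 𝒢.vertexToFree (Ξ.d₁ e) (𝒢.bd₁ e g) * (𝒢.letterInFree e)⁻¹ *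
      (𝒢.vertexToFree (Ξ.d₀ e) (𝒢.bd₀ e g))⁻¹ * 𝒢.letterInFree e}

/-- The closed normal subgroup `N(𝒢, Ξ, Θ)` of `W(𝒢, Ξ)` generated by the relators. -/
def relationSubgroup (Θ : Set E) : Subgroup 𝒢.freeProfiniteProduct :=
  (Subgroup.normalClosure (𝒢.relators Θ)).topologicalClosure

instance (Θ : Set E) : (𝒢.relationSubgroup Θ).Normal :=
  Subgroup.is_normal_topologicalClosure _

/-- The profinite fundamental group `W(𝒢, Ξ) / N(𝒢, Ξ, Θ)`, with the quotient topology. -/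
abbrev FundamentalGroup (Θ : Set E) : Type _ :=
  𝒢.freeProfiniteProduct ⧸ 𝒢.relationSubgroup Θ

/-- The canonical map from a vertex group to the profinite fundamental group. -/
def vertexMap (Θ : Set E) (v : V) : 𝒢.vertexGroup v →* 𝒢.FundamentalGroup Θ :=
  (QuotientGroup.mk' (𝒢.relationSubgroup Θ)).comp (𝒢.vertexToFree v)

end GraphOfProfiniteGroups

/-! ## Accessible subgroups -/

/-- A profinite group is strongly complete if all its normal subgroups of finite index are open. -/
def IsStronglyComplete (G : Type*) [Group G] [TopologicalSpace G] : Prop :=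
  ∀ N : Subgroup G, N.Normal → N.FiniteIndex → IsOpen (N : Set G)

/-- The subgroup `H` is accessible within `G` via `(𝒢, Ξ, Θ)`: `Θ` is a spanning tree of `Ξ`, the
vertex groups are strongly complete, the edge groups are finite, and `G` can be identified with the
profinite fundamental group in such a way that `H` is (the image of) a vertex group. -/
structure IsAccessibleVia {G : Type*} [Group G] [TopologicalSpace G] (H : Subgroup G)
    {V : Type uV} {E : Type uE} {Ξ : OrientedGraph V E}
    (𝒢 : GraphOfProfiniteGroups.{uV, uE, uX, uY} Ξ) (Θ : Set E) : Prop where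
  isSpanningTree : Ξ.IsSpanningTree Θ
  stronglyComplete : ∀ v, IsStronglyComplete (𝒢.vertexGroup v)
  finite_edgeGroup : ∀ e, Finite (𝒢.edgeGroup e)
  exists_vertex : ∃ (φ : 𝒢.FundamentalGroup Θ ≃ₜ* G) (v : V),
    ∀ g : G, g ∈ H ↔ ∃ x : 𝒢.vertexGroup v, φ (𝒢.vertexMap Θ v x) = g

/-! ## The completed group algebra -/

noncomputable section CompletedGroupAlgebra

variable (R G : Type*) [Ring R] [Group G] [TopologicalSpace G]

/-- The inverse limit of the group rings `R[G/U]`, over the open normal subgroups `U` of `G`, as a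
subring of their product. -/
def completedGroupAlgebraSubring :
    Subring (∀ U : OpenNormalSubgroup G, MonoidAlgebra R (G ⧸ U.toSubgroup)) where
  carrier := {x | ∀ (U U' : OpenNormalSubgroup G) (h : U.toSubgroup ≤ U'.toSubgroup),
    MonoidAlgebra.mapDomainRingHom R
      (QuotientGroup.map U.toSubgroup U'.toSubgroup (MonoidHom.id G) h) (x U) = x U'}
  mul_mem' hx hy U U' h := by simp only [Pi.mul_apply, map_mul, hx U U' h, hy U U' h]
  one_mem' U U' h := by simp only [Pi.one_apply, map_one]
  add_mem' hx hy U U' h := by simp only [Pi.add_apply, map_add, hx U U' h, hy U U' h]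
  zero_mem' U U' h := by simp only [Pi.zero_apply, map_zero]
  neg_mem' hx U U' h := by simp only [Pi.neg_apply, map_neg, hx U U' h]

/-- The completed group algebra `R[[G]]` of a profinite group `G` over a finite (discrete) ring
`R`: the inverse limit of the group rings `R[G/U]`, `U` an open normal subgroup of `G`. -/
def CompletedGroupAlgebra : Type _ := completedGroupAlgebraSubring R G

namespace CompletedGroupAlgebra

instance : Ring (CompletedGroupAlgebra R G) :=
  inferInstanceAs (Ring (completedGroupAlgebraSubring R G))

/-- The inverse limit topology, where each `R[G/U]` is discrete. -/
instance : TopologicalSpace (CompletedGroupAlgebra R G) :=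
  TopologicalSpace.induced
    (Subtype.val : completedGroupAlgebraSubring R G →
      ∀ U : OpenNormalSubgroup G, MonoidAlgebra R (G ⧸ U.toSubgroup))
    (@Pi.topologicalSpace _ _ fun _ => ⊥)

/-- The canonical homomorphism from `G` to the multiplicative monoid of `R[[G]]`. -/
def of : G →* CompletedGroupAlgebra R G where
  toFun g := ⟨fun U => MonoidAlgebra.of R (G ⧸ U.toSubgroup) (g : G ⧸ U.toSubgroup),
    fun U U' h => by simp [MonoidAlgebra.mapDomain_single]; rfl⟩
  map_one' := Subtype.ext <| funext fun _ => map_one _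
  map_mul' g h := Subtype.ext <| funext fun U =>
    map_mul (MonoidAlgebra.of R (G ⧸ U.toSubgroup)) (g : G ⧸ U.toSubgroup) h

/-- `R[[G]]` is a right `G`-module via multiplication on the right. -/
instance : DistribMulAction Gᵐᵒᵖ (CompletedGroupAlgebra R G) where
  smul g x := x * of R G g.unop
  one_smul x := (congrArg (x * ·) (map_one (of R G))).trans (mul_one x)
  mul_smul g h x := (congrArg (x * ·) (map_mul (of R G) h.unop g.unop)).trans
    (mul_assoc x _ _).symm
  smul_zero g := zero_mul (of R G g.unop)
  smul_add g x y := add_mul x y (of R G g.unop)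

end CompletedGroupAlgebra

end CompletedGroupAlgebra

/-! ## Right derivations -/

/-- A right derivation of `G` in a right `G`-module `M` (a left module over the opposite group):
`f (g h) = f(g) h + f(h)`. -/
def IsRightDerivation {G M : Type*} [Group G] [AddCommGroup M] [DistribMulAction Gᵐᵒᵖ M]
    (f : G → M) : Prop :=
  ∀ g h : G, f (g * h) = MulOpposite.op h • f g + f h

/-! For an edge `e` let σ_e be the sum of the elements of the image of its edge group in `G`, read
in `R[G/U]`. A right derivation `D` into `R[G/U]` is the translation part of a homomorphism `g ↦ (x
↦ x g + D g)` into a finite affine group, so the universal property of the fundamental group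
produces derivations from suitable values on vertex groups and stable letters (`exists_derivation`).

Let `v₀` be the vertex carrying `H`, and let κ_e be an integral potential with κ_e(v₀) = 0 whose
coboundary on the tree is the indicator of `e`. The derivation D_e is inner by κ_e(v) σ_e on the
vertex group at `v`, with a correction −σ_e on the letter t_e; the edge relations allow this because
σ_e is fixed by right multiplication by the edge group. These values determine D_e by density, so
the levels are compatible and define `f = (D_e)` into `R[[G]]`. It vanishes on `H` because κ_e(v₀) =
0.

Conversely, let all D_e(g) vanish and suppose g ∉ H. Choose `U` such that gU misses `H` and `U`
meets every edge image trivially, and let `c` be the sum over the image of `H` in `G/U`. At each end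
of an edge lying at `v₀`, a coset decomposition makes `c`, or c t_e, a left multiple of σ_e. Hence
the inner derivation x ↦ c(x − 1) is a left combination of the D_e (`sum_mul_edgeDerivation_eq`). So
c(g − 1) = 0, and comparing coefficients puts g in HU (`mem_of_subgroupSum_mul_eq`), a
contradiction. -/

/-! ## Affine transformations of a ring -/

/-- The group of maps `x ↦ x u + b` of a ring `T`, composed from left to right. -/
@[ext]
structure RightAffine (T : Type*) [Ring T] where
  unit : Tˣ
  trans : T

namespace RightAffine

variable {T : Type*} [Ring T]

instance : Mul (RightAffine T) := ⟨fun x y => ⟨x.unit * y.unit, x.trans * y.unit + y.trans⟩⟩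
instance : One (RightAffine T) := ⟨⟨1, 0⟩⟩
instance : Inv (RightAffine T) := ⟨fun x => ⟨x.unit⁻¹, -(x.trans * (x.unit⁻¹ : Tˣ))⟩⟩

@[simp] theorem mul_unit (x y : RightAffine T) : (x * y).unit = x.unit * y.unit := rfl
@[simp] theorem mul_trans (x y : RightAffine T) :
    (x * y).trans = x.trans * y.unit + y.trans := rfl
@[simp] theorem one_unit : (1 : RightAffine T).unit = 1 := rfl
@[simp] theorem one_trans : (1 : RightAffine T).trans = 0 := rfl
@[simp] theorem inv_unit (x : RightAffine T) : x⁻¹.unit = x.unit⁻¹ := rfl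
@[simp] theorem inv_trans (x : RightAffine T) :
    x⁻¹.trans = -(x.trans * (x.unit⁻¹ : Tˣ)) := rfl

instance : Group (RightAffine T) :=
  Group.ofLeftAxioms
    (fun x y z => by ext <;> simp [mul_assoc, add_mul, add_assoc])
    (fun x => by ext <;> simp)
    (fun x => by ext <;> simp)

instance [Finite T] : Finite (RightAffine T) :=
  Finite.of_injective (fun x => (x.unit, x.trans)) fun x y h => by
    ext
    · simpa using congrArg Units.val (congrArg Prod.fst h)
    · simpa using congrArg Prod.snd h

/-- The linear part of an affine transformation. -/
def unitHom (T : Type*) [Ring T] : RightAffine T →* Tˣ where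
  toFun := unit
  map_one' := rfl
  map_mul' _ _ := rfl

/-- The linear transformations `x ↦ x u`, conjugated by the translation by `m`. -/
def conjLinear (m : T) : Tˣ →* RightAffine T where
  toFun u := ⟨u, m * (u - 1)⟩
  map_one' := by ext <;> simp
  map_mul' u v := by
    ext
    · simp
    · simp only [mul_trans, Units.val_mul]
      noncomm_ring

end RightAffine

/-! ## Derivations along a homomorphism into a ring -/

/-- `D (g h) = D(g) ι(h) + D(h)`: a right derivation with values in the right module defined by a
multiplicative homomorphism `ι` to a ring. -/
def IsDerivationAlong {G T : Type*} [Group G] [Ring T] (ι : G →* T) (D : G → T) : Prop :=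
  ∀ g h, D (g * h) = D g * ι h + D h

namespace IsDerivationAlong

variable {G T : Type*} [Group G] [Ring T] {ι : G →* T} {D D' : G → T}

theorem map_one (hD : IsDerivationAlong ι D) : D 1 = 0 := by
  simpa using hD 1 1

theorem map_inv (hD : IsDerivationAlong ι D) (g : G) : D g⁻¹ = -(D g * ι g⁻¹) := by
  have h := hD g g⁻¹
  rw [mul_inv_cancel, hD.map_one] at h
  exact (neg_eq_of_add_eq_zero_right h.symm).symm

theorem inner (ι : G →* T) (c : T) : IsDerivationAlong ι fun g => c * (ι g - 1) := fun g h => by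
  simp only [_root_.map_mul]
  noncomm_ring

theorem sum_mul {E : Type*} [Fintype E] {D : E → G → T} (hD : ∀ e, IsDerivationAlong ι (D e))
    (a : E → T) : IsDerivationAlong ι fun g => ∑ e, a e * D e g := fun g h => by
  simp only [hD _ g h, mul_add, Finset.sum_add_distrib, Finset.sum_mul, mul_assoc]

theorem map_ringHom {T' : Type*} [Ring T'] (hD : IsDerivationAlong ι D) (p : T →+* T') :
    IsDerivationAlong ((p : T →* T').comp ι) fun g => p (D g) := fun g h => by
  simp [hD g h]

/-- The subgroup on which two derivations agree. -/
def eqLocus (hD : IsDerivationAlong ι D) (hD' : IsDerivationAlong ι D') : Subgroup G where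
  carrier := {g | D g = D' g}
  one_mem' := hD.map_one.trans hD'.map_one.symm
  mul_mem' {g h} hg hh := by
    simp only [Set.mem_ofPred_eq] at hg hh ⊢
    rw [hD, hD', hg, hh]
  inv_mem' {g} hg := by
    simp only [Set.mem_ofPred_eq] at hg ⊢
    rw [hD.map_inv, hD'.map_inv, hg]

end IsDerivationAlong

/-! ## Universal property of the profinite fundamental group -/

namespace GraphOfProfiniteGroups

variable {V : Type uV} {E : Type uE} {Ξ : OrientedGraph V E}
  (𝒢 : GraphOfProfiniteGroups.{uV, uE, uX, uY} Ξ)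

/-- A subgroup of the abstract free product containing the vertex groups and the stable letters
is everything. -/
theorem eq_top_of_generators_mem (S : Subgroup 𝒢.AbstractFreeProduct)
    (hv : ∀ v x, 𝒢.abstractVertex v x ∈ S) (he : ∀ e, 𝒢.abstractLetter e ∈ S) : S = ⊤ := by
  refine (Subgroup.eq_top_iff' S).2 fun a => ?_
  induction a using Monoid.Coprod.induction_on with
  | inl y =>
    induction y using Monoid.CoprodI.induction_on with
    | one => simp
    | of v x => exact hv v x
    | mul x y hx hy => rw [_root_.map_mul]; exact S.mul_mem hx hy
  | inr y =>
    induction y using FreeGroup.induction_on with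
    | C1 => simp
    | of e => exact he e
    | inv_of e h => rw [_root_.map_inv]; exact S.inv_mem h
    | mul x y hx hy => rw [_root_.map_mul]; exact S.mul_mem hx hy
  | mul x y hx hy => exact S.mul_mem hx hy

variable (Θ : Set E)

theorem denseRange_toFreeProfiniteProduct : DenseRange 𝒢.toFreeProfiniteProduct := by
  intro w
  rw [closure_subtype, ← Set.range_comp]
  exact w.2

/-- The kernel of `ψ` is itself admissible, so `ψ` extends to the profinite product as a coordinate
projection followed by an injection. The extension has closed kernel, which therefore contains the
closed normal subgroup generated by the relators. -/
theorem exists_lift {S : Type*} [Group S] [Finite S] (ψ : 𝒢.AbstractFreeProduct →* S)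
    (hv : ∀ v, IsOpen ((ψ.comp (𝒢.abstractVertex v)).ker : Set (𝒢.vertexGroup v)))
    (ht : ∀ e ∈ Θ, ψ (𝒢.abstractLetter e) = 1)
    (hr : ∀ (e : E) (g : 𝒢.edgeGroup e),
      ψ (𝒢.abstractLetter e) * ψ (𝒢.abstractVertex (Ξ.d₁ e) (𝒢.bd₁ e g)) =
        ψ (𝒢.abstractVertex (Ξ.d₀ e) (𝒢.bd₀ e g)) * ψ (𝒢.abstractLetter e)) :
    ∃ Ψ : 𝒢.FundamentalGroup Θ →* S, IsLocallyConstant Ψ ∧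
      ∀ a, Ψ (QuotientGroup.mk' _ (𝒢.toFreeProfiniteProduct a)) = ψ a := by
  let N : 𝒢.AdmissibleSubgroup :=
    { toSubgroup := ψ.ker
      normal := inferInstance
      finiteIndex := inferInstance
      isOpen_comap := hv }
  let p : 𝒢.freeProfiniteProduct →* 𝒢.FiniteQuotient N :=
    (Pi.evalMonoidHom _ N).comp 𝒢.freeProfiniteProduct.subtype
  have hp : Continuous p := (continuous_apply N).comp continuous_subtype_val
  let j : 𝒢.FiniteQuotient N →* S := QuotientGroup.kerLift ψ
  have hjp (a) : j (p (𝒢.toFreeProfiniteProduct a)) = ψ a := rfl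
  let q := j.comp p
  have hq : IsLocallyConstant q := (IsLocallyConstant.of_discrete j).comp_continuous hp
  have hker : 𝒢.relationSubgroup Θ ≤ q.ker := by
    refine Subgroup.topologicalClosure_minimal _ (Subgroup.normalClosure_le_normal ?_)
      (hq.isClosed_fiber 1)
    rintro _ (⟨e, he, rfl⟩ | ⟨e, g, rfl⟩)
    · exact (hjp _).trans (ht e he)
    · have h := hr e g
      simp only [SetLike.mem_coe, MonoidHom.mem_ker, _root_.map_mul, _root_.map_inv]
      change ψ _ * (ψ _)⁻¹ * (ψ _)⁻¹ * ψ _ = 1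
      rw [mul_assoc, mul_assoc, ← mul_assoc (ψ (𝒢.abstractLetter e))⁻¹, ← mul_inv_rev, ← h]
      group
  refine ⟨QuotientGroup.lift _ q hker, fun s => ?_, hjp⟩
  exact isOpen_coinduced.2 (hq s)

variable {G : Type*} [Group G] [TopologicalSpace G]

/-- The homomorphism from the abstract free product to a group identified with the profinite
fundamental group. -/
def toGroup {Θ : Set E} (φ : 𝒢.FundamentalGroup Θ ≃ₜ* G) : 𝒢.AbstractFreeProduct →* G :=
  (φ : 𝒢.FundamentalGroup Θ →* G).comp
    ((QuotientGroup.mk' (𝒢.relationSubgroup Θ)).comp 𝒢.toFreeProfiniteProduct)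

variable {Θ} (φ : 𝒢.FundamentalGroup Θ ≃ₜ* G)

theorem denseRange_toGroup : DenseRange (𝒢.toGroup φ) := by
  have h : DenseRange (QuotientGroup.mk' (𝒢.relationSubgroup Θ)) :=
    (QuotientGroup.mk'_surjective _).denseRange
  have h' := h.comp 𝒢.denseRange_toFreeProfiniteProduct QuotientGroup.continuous_mk
  exact φ.surjective.denseRange.comp h' φ.continuous

theorem continuous_toGroup_vertex (v : V) :
    Continuous fun x => 𝒢.toGroup φ (𝒢.abstractVertex v x) := by
  refine φ.continuous.comp (QuotientGroup.continuous_mk.comp ?_)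
  refine Continuous.subtype_mk (continuous_pi fun N => ?_) _
  let q : 𝒢.vertexGroup v →* 𝒢.FiniteQuotient N :=
    (QuotientGroup.mk' N.toSubgroup).comp (𝒢.abstractVertex v)
  refine continuous_of_continuousAt_one q ?_
  rw [ContinuousAt, _root_.map_one, nhds_discrete (𝒢.FiniteQuotient N), Filter.tendsto_pure]
  filter_upwards [(N.isOpen_comap v).mem_nhds (one_mem _)] with x hx
  exact (QuotientGroup.eq_one_iff _).2 hx

theorem toGroup_letter_eq_one {e : E} (he : e ∈ Θ) :
    𝒢.toGroup φ (𝒢.abstractLetter e) = 1 := by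
  have : QuotientGroup.mk' (𝒢.relationSubgroup Θ) (𝒢.letterInFree e) = 1 :=
    (QuotientGroup.eq_one_iff _).2 <| Subgroup.le_topologicalClosure _ <|
      Subgroup.subset_normalClosure (Or.inl ⟨e, he, rfl⟩)
  exact (congrArg φ this).trans (_root_.map_one φ)

theorem toGroup_letter_mul (e : E) (g : 𝒢.edgeGroup e) :
    𝒢.toGroup φ (𝒢.abstractLetter e) * 𝒢.toGroup φ (𝒢.abstractVertex (Ξ.d₁ e) (𝒢.bd₁ e g)) =
      𝒢.toGroup φ (𝒢.abstractVertex (Ξ.d₀ e) (𝒢.bd₀ e g)) *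
        𝒢.toGroup φ (𝒢.abstractLetter e) := by
  have : QuotientGroup.mk' (𝒢.relationSubgroup Θ)
      (𝒢.vertexToFree (Ξ.d₁ e) (𝒢.bd₁ e g) * (𝒢.letterInFree e)⁻¹ *
      (𝒢.vertexToFree (Ξ.d₀ e) (𝒢.bd₀ e g))⁻¹ * 𝒢.letterInFree e) = 1 :=
    (QuotientGroup.eq_one_iff _).2 <| Subgroup.le_topologicalClosure _ <|
      Subgroup.subset_normalClosure (Or.inr ⟨e, g, rfl⟩)
  have h := (congrArg φ this).trans (_root_.map_one φ)
  simp only [_root_.map_mul, _root_.map_inv] at h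
  change 𝒢.toGroup φ (𝒢.abstractVertex (Ξ.d₁ e) (𝒢.bd₁ e g)) *
    (𝒢.toGroup φ (𝒢.abstractLetter e))⁻¹ *
    (𝒢.toGroup φ (𝒢.abstractVertex (Ξ.d₀ e) (𝒢.bd₀ e g)))⁻¹ *
    𝒢.toGroup φ (𝒢.abstractLetter e) = 1 at h
  rw [mul_assoc, mul_eq_one_iff_eq_inv, mul_inv_rev, inv_inv, mul_inv_eq_iff_eq_mul] at h
  rw [h]
  group

theorem exists_lift_toGroup {S : Type*} [Group S] [Finite S] (ψ : 𝒢.AbstractFreeProduct →* S)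
    (hv : ∀ v, IsOpen ((ψ.comp (𝒢.abstractVertex v)).ker : Set (𝒢.vertexGroup v)))
    (ht : ∀ e ∈ Θ, ψ (𝒢.abstractLetter e) = 1)
    (hr : ∀ (e : E) (g : 𝒢.edgeGroup e),
      ψ (𝒢.abstractLetter e) * ψ (𝒢.abstractVertex (Ξ.d₁ e) (𝒢.bd₁ e g)) =
        ψ (𝒢.abstractVertex (Ξ.d₀ e) (𝒢.bd₀ e g)) * ψ (𝒢.abstractLetter e)) :
    ∃ Ψ : G →* S, IsLocallyConstant Ψ ∧ ∀ a, Ψ (𝒢.toGroup φ a) = ψ a := by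
  obtain ⟨Ψ, hc, hΨ⟩ := 𝒢.exists_lift Θ ψ hv ht hr
  refine ⟨Ψ.comp (φ.symm : G →* 𝒢.FundamentalGroup Θ), hc.comp_continuous φ.symm.continuous,
    fun a => ?_⟩
  rw [← hΨ]
  exact congrArg Ψ (φ.symm_apply_apply _)

/-- Two derivations agree on a subgroup, and the vertex groups and letters generate a dense one. -/
theorem derivation_ext {T : Type*} [Ring T] {ι : G →* T} {D D' : G → T}
    (hD : IsDerivationAlong ι D) (hD' : IsDerivationAlong ι D') (hc : IsLocallyConstant D)
    (hc' : IsLocallyConstant D')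
    (hv : ∀ v x, D (𝒢.toGroup φ (𝒢.abstractVertex v x)) =
      D' (𝒢.toGroup φ (𝒢.abstractVertex v x)))
    (ht : ∀ e, D (𝒢.toGroup φ (𝒢.abstractLetter e)) = D' (𝒢.toGroup φ (𝒢.abstractLetter e))) :
    D = D' := by
  have htop := 𝒢.eq_top_of_generators_mem ((hD.eqLocus hD').comap (𝒢.toGroup φ)) hv ht
  let _ : TopologicalSpace T := ⊥
  have : DiscreteTopology T := ⟨rfl⟩
  refine (𝒢.denseRange_toGroup φ).equalizer hc.continuous hc'.continuous (funext fun a => ?_)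
  have : a ∈ (hD.eqLocus hD').comap (𝒢.toGroup φ) := htop ▸ Subgroup.mem_top a
  exact this

/-- The derivation is the translation part of a homomorphism to `RightAffine T`. The condition `hn`
is what the edge relations demand, and `hm` what the relators `t_e = 1` on the tree demand. -/
theorem exists_derivation {T : Type*} [Ring T] [Finite T] {ι : G →* T}
    (hι : IsLocallyConstant ι) (m : V → T) (n : E → T)
    (hn : ∀ e g, n e * ι (𝒢.toGroup φ (𝒢.abstractVertex (Ξ.d₁ e) (𝒢.bd₁ e g))) = n e)
    (hm : ∀ e ∈ Θ, m (Ξ.d₀ e) - m (Ξ.d₁ e) = n e) :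
    ∃ D : G → T, IsLocallyConstant D ∧ IsDerivationAlong ι D ∧
      (∀ v x, D (𝒢.toGroup φ (𝒢.abstractVertex v x)) =
        m v * (ι (𝒢.toGroup φ (𝒢.abstractVertex v x)) - 1)) ∧
      ∀ e, D (𝒢.toGroup φ (𝒢.abstractLetter e)) =
        m (Ξ.d₀ e) * ι (𝒢.toGroup φ (𝒢.abstractLetter e)) - m (Ξ.d₁ e) - n e := by
  let u : G →* Tˣ := ι.toHomUnits
  have hu (g) : (u g : T) = ι g := rfl
  let ψ : 𝒢.AbstractFreeProduct →* RightAffine T := Monoid.Coprod.lift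
    (Monoid.CoprodI.lift fun v =>
      (RightAffine.conjLinear (m v)).comp (u.comp ((𝒢.toGroup φ).comp (𝒢.abstractVertex v))))
    (FreeGroup.lift fun e => ⟨u (𝒢.toGroup φ (𝒢.abstractLetter e)),
      m (Ξ.d₀ e) * ι (𝒢.toGroup φ (𝒢.abstractLetter e)) - m (Ξ.d₁ e) - n e⟩)
  have hψv (v x) : ψ (𝒢.abstractVertex v x) = ⟨u (𝒢.toGroup φ (𝒢.abstractVertex v x)),
      m v * (ι (𝒢.toGroup φ (𝒢.abstractVertex v x)) - 1)⟩ := by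
    simp [ψ, abstractVertex, RightAffine.conjLinear, hu]
  have hψt (e) : ψ (𝒢.abstractLetter e) = ⟨u (𝒢.toGroup φ (𝒢.abstractLetter e)),
      m (Ξ.d₀ e) * ι (𝒢.toGroup φ (𝒢.abstractLetter e)) - m (Ξ.d₁ e) - n e⟩ := by
    simp [ψ, abstractLetter]
  have hψu (a) : (ψ a).unit = u (𝒢.toGroup φ a) := by
    let S := ((RightAffine.unitHom T).comp ψ).eqLocus (u.comp (𝒢.toGroup φ))
    have hS : S = ⊤ := 𝒢.eq_top_of_generators_mem S
      (fun v x => congrArg RightAffine.unit (hψv v x))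
      (fun e => congrArg RightAffine.unit (hψt e))
    have : a ∈ S := hS ▸ Subgroup.mem_top a
    exact this
  -- On a vertex group the translation part `m v * (ι x - 1)` vanishes as soon as the linear part is
  -- trivial.
  have hker (v) : IsOpen ((ψ.comp (𝒢.abstractVertex v)).ker : Set (𝒢.vertexGroup v)) := by
    have h : ((ψ.comp (𝒢.abstractVertex v)).ker : Set (𝒢.vertexGroup v)) =
        (fun x => 𝒢.toGroup φ (𝒢.abstractVertex v x)) ⁻¹' (ι ⁻¹' {1}) := by
      ext x
      simp only [SetLike.mem_coe, MonoidHom.mem_ker, MonoidHom.comp_apply, hψv, Set.mem_preimage,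
        Set.mem_singleton_iff]
      refine ⟨fun h => congrArg (fun y => (y.unit : T)) h, fun h => ?_⟩
      ext <;> simp [hu, h]
    rw [h]
    exact (hι {1}).preimage (𝒢.continuous_toGroup_vertex φ v)
  have hone (e) (he : e ∈ Θ) : ψ (𝒢.abstractLetter e) = 1 := by
    rw [hψt, toGroup_letter_eq_one 𝒢 φ he]
    ext <;> simp [hm e he]
  have hrel (e) (g : 𝒢.edgeGroup e) :
      ψ (𝒢.abstractLetter e) * ψ (𝒢.abstractVertex (Ξ.d₁ e) (𝒢.bd₁ e g)) =
        ψ (𝒢.abstractVertex (Ξ.d₀ e) (𝒢.bd₀ e g)) * ψ (𝒢.abstractLetter e) := by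
    have h := congrArg u (𝒢.toGroup_letter_mul φ e g)
    have h' := congrArg ι (𝒢.toGroup_letter_mul φ e g)
    simp only [_root_.map_mul] at h h'
    rw [hψt, hψv, hψv]
    ext
    · simpa using congrArg Units.val h
    -- The terms in `m` cancel by the relation in `G`; what is left is `n e * ι (∂₁ g)` against `n
    -- e`, which `hn` identifies.
    · simp only [RightAffine.mul_trans, hu, sub_mul, hn, mul_sub, mul_one, mul_assoc, h']
      abel
  obtain ⟨Ψ, hΨc, hΨ⟩ := 𝒢.exists_lift_toGroup φ ψ hker hone hrel
  have hΨu : ∀ g, (Ψ g).unit = u g := by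
    let _ : TopologicalSpace T := ⊥
    have : DiscreteTopology T := ⟨rfl⟩
    have h1 : Continuous fun g => ((Ψ g).unit : T) :=
      (hΨc.comp fun x => (x.unit : T)).continuous
    have := (𝒢.denseRange_toGroup φ).equalizer h1 hι.continuous (funext fun a => by
      simp [hΨ, hψu, hu])
    exact fun g => Units.ext (congrFun this g)
  refine ⟨fun g => (Ψ g).trans, hΨc.comp RightAffine.trans, fun g h => ?_, fun v x => ?_,
    fun e => ?_⟩
  · simp [hΨu, hu]
  · simp [hΨ, hψv]
  · simp [hΨ, hψt]

end GraphOfProfiniteGroups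

/-! ## Potentials on a spanning tree -/

namespace OrientedGraph

variable {V E : Type*} {Ξ : OrientedGraph V E}

/-- For every edge `e` of a spanning tree there is an integral function on the vertices whose
coboundary on the tree is the indicator function of `e`. -/
theorem IsSpanningTree.exists_potential {Θ : Set E} (h : Ξ.IsSpanningTree Θ) (v₀ : V) (e : E) :
    ∃ κ : V → ℤ, κ v₀ = 0 ∧
      (e ∈ Θ → κ (Ξ.d₀ e) - κ (Ξ.d₁ e) = 1) ∧
      ∀ e' ∈ Θ, e' ≠ e → κ (Ξ.d₀ e') - κ (Ξ.d₁ e') = 0 := by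
  classical
  -- The indicator of the component of `d₀ e` in the forest obtained by deleting `e`; subtracting
  -- its value at `v₀` normalizes it.
  let χ : V → ℤ := fun v => if Ξ.Joined (Θ \ {e}) (Ξ.d₀ e) v then 1 else 0
  refine ⟨fun v => χ v - χ v₀, sub_self _, fun he => ?_, fun e' he' hne => ?_⟩
  · have h₀ : χ (Ξ.d₀ e) = 1 := if_pos (Relation.EqvGen.refl _)
    have h₁ : χ (Ξ.d₁ e) = 0 := if_neg (h.acyclic e he)
    simp [h₀, h₁]
  · have hj : Ξ.Joined (Θ \ {e}) (Ξ.d₀ e') (Ξ.d₁ e') :=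
      Relation.EqvGen.rel _ _ ⟨e', ⟨he', hne⟩, rfl, rfl⟩
    have : χ (Ξ.d₀ e') = χ (Ξ.d₁ e') :=
      if_congr ⟨fun h => h.trans _ _ _ hj, fun h => h.trans _ _ _ (hj.symm _ _)⟩ rfl rfl
    simp [this]

theorem Joined.eq_of_forall_edge {X : Type*} {A : Set E} {p : V → X}
    (hp : ∀ e ∈ A, p (Ξ.d₀ e) = p (Ξ.d₁ e)) {v w : V} (h : Ξ.Joined A v w) : p v = p w := by
  induction h with
  | rel x y hxy =>
    obtain ⟨e, he, rfl, rfl⟩ := hxy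
    exact hp e he
  | refl => rfl
  | symm _ _ _ ih => exact ih.symm
  | trans _ _ _ _ _ ih ih' => exact ih.trans ih'

end OrientedGraph

/-! ## Sums over finite subgroups -/

section SubgroupSum

variable {G T : Type*} [Group G] [Ring T]

/-- The sum of the elements of a finite subgroup, in a ring to which the group is mapped. -/
noncomputable def subgroupSum (ι : G →* T) (P : Subgroup G) [Finite P] : T :=
  let _ := Fintype.ofFinite P
  ∑ x : P, ι x

theorem subgroupSum_mul (ι : G →* T) (P : Subgroup G) [Finite P] {g : G} (hg : g ∈ P) :
    subgroupSum ι P * ι g = subgroupSum ι P := by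
  let _ := Fintype.ofFinite P
  simp only [subgroupSum, Finset.sum_mul, ← map_mul]
  exact Fintype.sum_equiv (Equiv.mulRight ⟨g, hg⟩) _ _ fun _ => rfl

/-- This holds because the sum is indexed by `P` and not by its image under `ι`: multiplicities are
kept, which makes the sums compatible between levels. -/
theorem map_subgroupSum {T' : Type*} [Ring T'] (p : T →+* T') (ι : G →* T) (P : Subgroup G)
    [Finite P] : p (subgroupSum ι P) = subgroupSum ((p : T →* T').comp ι) P := by
  simp [subgroupSum]

/-- The sum over a subgroup is a left multiple of the sum over a smaller subgroup. -/
theorem exists_subgroupSum_eq_mul (ι : G →* T) (K : Subgroup G) [Finite K] {P : Type*} [Group P]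
    [Fintype P] (j : P →* G) (hj : Function.Injective j) (hK : ∀ x, j x ∈ K) :
    ∃ a, subgroupSum ι K = a * ∑ x, ι (j x) := by
  let _ := Fintype.ofFinite K
  let j' : P →* K := j.codRestrict K hK
  have hj' : Function.Injective j' := fun x y h => hj (congrArg Subtype.val h)
  -- The left factor is the sum over a left transversal of the smaller subgroup.
  obtain ⟨S, hS, -⟩ := j'.range.exists_isComplement_left 1
  let _ := Fintype.ofFinite S
  let _ := Fintype.ofFinite j'.range
  refine ⟨∑ s : S, ι (s : K), ?_⟩
  have h₁ : ∑ x, ι (j x) = ∑ y : j'.range, ι (y : K) :=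
    Fintype.sum_equiv (MonoidHom.ofInjective hj').toEquiv _ _ fun _ => rfl
  rw [h₁, Finset.sum_mul_sum, ← Fintype.sum_prod_type', subgroupSum]
  exact (Fintype.sum_equiv (Equiv.ofBijective _ hS) _ _ fun y => (map_mul ι _ _).symm).symm

/-- The stabilizer, under right multiplication, of the sum over a subgroup in the group ring is
that subgroup. -/
theorem mem_of_subgroupSum_mul_eq {R : Type*} [Ring R] [Nontrivial R] (K : Subgroup G) [Finite K]
    {g : G} (h : subgroupSum (MonoidAlgebra.of R G) K * (MonoidAlgebra.of R G g - 1) = 0) :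
    g ∈ K := by
  classical
  let _ := Fintype.ofFinite K
  have hc (x : G) : (subgroupSum (MonoidAlgebra.of R G) K).coeff x = if x ∈ K then 1 else 0 := by
    have (k : K) : (Finsupp.single (k : G) (1 : R)) x = if x = k then 1 else 0 := by
      rw [Finsupp.single_apply]
      exact if_congr eq_comm rfl rfl
    simp only [subgroupSum, MonoidAlgebra.of_apply, MonoidAlgebra.coeff_sum,
      MonoidAlgebra.coeff_single, Finsupp.finsetSum_apply, this]
    split_ifs with hx
    · rw [Finset.sum_eq_single ⟨x, hx⟩] <;> aesop
    · exact Finset.sum_eq_zero fun k _ => if_neg fun h => hx (by rw [h]; exact k.2)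
  rw [mul_sub, mul_one, sub_eq_zero] at h
  -- If `g ∉ K`, the coefficient at `g` is 1 in the translate by `g` and 0 in the sum itself.
  have h' := congrArg (fun y => y.coeff g) h
  by_contra hg
  simp [MonoidAlgebra.of_apply, hc, hg] at h'

end SubgroupSum

/-! ## Derivations with values in the group rings of the finite quotients -/

section LevelHom

variable (R : Type*) [Ring R] {G : Type*} [Group G] [TopologicalSpace G]

/-- The map from `G` to the group ring `R[G/U]`. -/
noncomputable def levelHom (U : OpenNormalSubgroup G) : G →* MonoidAlgebra R (G ⧸ U.toSubgroup) :=
  (MonoidAlgebra.of R (G ⧸ U.toSubgroup)).comp (QuotientGroup.mk' U.toSubgroup)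

theorem mapDomainRingHom_comp_levelHom {U U' : OpenNormalSubgroup G}
    (h : U.toSubgroup ≤ U'.toSubgroup) :
    ((MonoidAlgebra.mapDomainRingHom R
      (QuotientGroup.map U.toSubgroup U'.toSubgroup (MonoidHom.id G) h) :
      MonoidAlgebra R (G ⧸ U.toSubgroup) →* MonoidAlgebra R (G ⧸ U'.toSubgroup))).comp
      (levelHom R U) = levelHom R U' := by
  ext g : 1
  simp only [levelHom, MonoidHom.comp_apply, MonoidAlgebra.of_apply, MonoidHom.coe_coe,
    MonoidAlgebra.mapDomainRingHom_apply, MonoidAlgebra.mapDomain_single]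
  rfl

variable [IsTopologicalGroup G]

theorem isLocallyConstant_levelHom (U : OpenNormalSubgroup G) :
    IsLocallyConstant (levelHom R U) := by
  have := QuotientGroup.discreteTopology U.isOpen'
  exact (IsLocallyConstant.of_discrete (MonoidAlgebra.of R (G ⧸ U.toSubgroup))).comp_continuous
    QuotientGroup.continuous_mk

end LevelHom

instance MonoidAlgebra.instFinite (R Q : Type*) [Semiring R] [Finite R] [Finite Q] :
    Finite (MonoidAlgebra R Q) :=
  Finite.of_equiv _ (MonoidAlgebra.coeffEquiv.trans Finsupp.equivFunOnFinite).symm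

/-! ### The derivation attached to an edge, and the detection of the vertex group. -/

namespace GraphOfProfiniteGroups

variable {V : Type uV} {E : Type uE} {Ξ : OrientedGraph V E}
  (𝒢 : GraphOfProfiniteGroups.{uV, uE, uX, uY} Ξ) {G : Type*} [Group G] [TopologicalSpace G]
  {Θ : Set E} (φ : 𝒢.FundamentalGroup Θ ≃ₜ* G)

/-- The image of an edge group in the profinite fundamental group, via its terminal vertex. -/
def edgeImage (e : E) : Subgroup G :=
  (((𝒢.toGroup φ).comp (𝒢.abstractVertex (Ξ.d₁ e))).comp
    (𝒢.bd₁ e : 𝒢.edgeGroup e →* 𝒢.vertexGroup (Ξ.d₁ e))).range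

instance (e : E) [Finite (𝒢.edgeGroup e)] : Finite (𝒢.edgeImage φ e) :=
  Finite.of_surjective _ (MonoidHom.rangeRestrict_surjective _)

/-- The characterization of the derivation attached to an edge `e`: it is inner on each vertex
group, by a multiple of the sum over the edge group. -/
structure IsEdgeDerivation [∀ e, Finite (𝒢.edgeGroup e)] {T : Type*} [Ring T] (ι : G →* T)
    (κ : V → ℤ) (e : E) (D : G → T) : Prop where
  isLocallyConstant : IsLocallyConstant D
  isDerivationAlong : IsDerivationAlong ι D
  vertex : ∀ v x, D (𝒢.toGroup φ (𝒢.abstractVertex v x)) =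
    κ v * subgroupSum ι (𝒢.edgeImage φ e) * (ι (𝒢.toGroup φ (𝒢.abstractVertex v x)) - 1)
  letter_self : D (𝒢.toGroup φ (𝒢.abstractLetter e)) =
    κ (Ξ.d₀ e) * subgroupSum ι (𝒢.edgeImage φ e) * ι (𝒢.toGroup φ (𝒢.abstractLetter e)) -
      κ (Ξ.d₁ e) * subgroupSum ι (𝒢.edgeImage φ e) - subgroupSum ι (𝒢.edgeImage φ e)
  letter_of_ne : ∀ e' ≠ e, D (𝒢.toGroup φ (𝒢.abstractLetter e')) =
    κ (Ξ.d₀ e') * subgroupSum ι (𝒢.edgeImage φ e) * ι (𝒢.toGroup φ (𝒢.abstractLetter e')) -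
      κ (Ξ.d₁ e') * subgroupSum ι (𝒢.edgeImage φ e)

variable [∀ e, Finite (𝒢.edgeGroup e)]

theorem exists_isEdgeDerivation {T : Type*} [Ring T] [Finite T] {ι : G →* T}
    (hι : IsLocallyConstant ι) {κ : V → ℤ} {e : E}
    (hκ : e ∈ Θ → κ (Ξ.d₀ e) - κ (Ξ.d₁ e) = 1)
    (hκ' : ∀ e' ∈ Θ, e' ≠ e → κ (Ξ.d₀ e') - κ (Ξ.d₁ e') = 0) :
    ∃ D, 𝒢.IsEdgeDerivation φ ι κ e D := by
  classical
  obtain ⟨D, h₁, h₂, h₃, h₄⟩ := 𝒢.exists_derivation φ hι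
    (fun v => κ v * subgroupSum ι (𝒢.edgeImage φ e))
    (fun e' => if e' = e then subgroupSum ι (𝒢.edgeImage φ e) else 0)
    (fun e' g => by
      split_ifs with h
      · subst h
        exact subgroupSum_mul ι _ ⟨g, rfl⟩
      · simp)
    (fun e' he' => by
      rw [← sub_mul, ← Int.cast_sub]
      split_ifs with h
      · subst h
        simp [hκ he']
      · simp [hκ' e' he' h])
  exact ⟨D, h₁, h₂, h₃, by simpa using h₄ e, fun e' he' => by simpa [he'] using h₄ e'⟩

variable {𝒢 φ}

theorem IsEdgeDerivation.eq {T : Type*} [Ring T] {ι : G →* T} {κ : V → ℤ} {e : E} {D D' : G → T}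
    (h : 𝒢.IsEdgeDerivation φ ι κ e D) (h' : 𝒢.IsEdgeDerivation φ ι κ e D') : D = D' := by
  refine 𝒢.derivation_ext φ h.isDerivationAlong h'.isDerivationAlong h.isLocallyConstant
    h'.isLocallyConstant (fun v x => by rw [h.vertex, h'.vertex]) fun e' => ?_
  by_cases he : e' = e
  · rw [he, h.letter_self, h'.letter_self]
  · rw [h.letter_of_ne e' he, h'.letter_of_ne e' he]

theorem IsEdgeDerivation.map {T T' : Type*} [Ring T] [Ring T'] {ι : G →* T} {κ : V → ℤ} {e : E}
    {D : G → T} (h : 𝒢.IsEdgeDerivation φ ι κ e D) (p : T →+* T') :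
    𝒢.IsEdgeDerivation φ ((p : T →* T').comp ι) κ e fun g => p (D g) where
  isLocallyConstant := h.isLocallyConstant.comp p
  isDerivationAlong := h.isDerivationAlong.map_ringHom p
  vertex v x := by simp [h.vertex, map_subgroupSum]
  letter_self := by simp [h.letter_self, map_subgroupSum]
  letter_of_ne e' he' := by simp [h.letter_of_ne e' he', map_subgroupSum]

/-- An inner derivation by an element fixed by a vertex group is a combination of the derivations
attached to the edges, if the sums over the edge groups divide the differences prescribed by
the coboundary. -/
theorem sum_mul_edgeDerivation_eq [Fintype E] {T : Type*} [Ring T] {ι : G →* T}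
    (hι : IsLocallyConstant ι) (hΘ : Ξ.IsSpanningTree Θ) {v₀ : V} {κ : E → V → ℤ}
    (hκ₀ : ∀ e, κ e v₀ = 0)
    (hκ : ∀ e ∈ Θ, κ e (Ξ.d₀ e) - κ e (Ξ.d₁ e) = 1)
    (hκ' : ∀ e, ∀ e' ∈ Θ, e' ≠ e → κ e (Ξ.d₀ e') - κ e (Ξ.d₁ e') = 0)
    {D : E → G → T} (hD : ∀ e, 𝒢.IsEdgeDerivation φ ι (κ e) e (D e)) {c : T} {ν : V → T}
    (hν₀ : ν v₀ = -c) (hν : ∀ v ≠ v₀, ν v = 0)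
    (hc : ∀ x, c * ι (𝒢.toGroup φ (𝒢.abstractVertex v₀ x)) = c) {a : E → T}
    (ha : ∀ e, a e * subgroupSum ι (𝒢.edgeImage φ e) =
      ν (Ξ.d₀ e) * ι (𝒢.toGroup φ (𝒢.abstractLetter e)) - ν (Ξ.d₁ e)) (g : G) :
    ∑ e, a e * D e g = c * (ι g - 1) := by
  classical
  -- On the vertex group at `v` the combination `∑ e, a e * D e` is inner by `p v`. Along tree edges
  -- `p` and `ν` have the same coboundary, so they differ by a constant, which the values at `v₀`
  -- show to be `c`.
  let p : V → T := fun v => ∑ e, a e * (κ e v * subgroupSum ι (𝒢.edgeImage φ e))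
  have hedge : ∀ e ∈ Θ, p (Ξ.d₀ e) - ν (Ξ.d₀ e) = p (Ξ.d₁ e) - ν (Ξ.d₁ e) := fun e he => by
    have h₁ : p (Ξ.d₀ e) - p (Ξ.d₁ e) = a e * subgroupSum ι (𝒢.edgeImage φ e) := by
      simp only [p, ← Finset.sum_sub_distrib, ← mul_sub, ← sub_mul, ← Int.cast_sub]
      rw [Finset.sum_eq_single e, hκ e he]
      · simp
      · intro e' _ hne
        simp [hκ' e' e he hne.symm]
      · simp
    rw [ha, 𝒢.toGroup_letter_eq_one φ he, map_one, mul_one] at h₁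
    rw [sub_eq_sub_iff_sub_eq_sub, h₁]
  have hp (v) : p v = ν v + c := by
    have h := (hΘ.connected v v₀).eq_of_forall_edge (p := fun v => p v - ν v) hedge
    have h₀ : p v₀ = 0 := by simp [p, hκ₀]
    simp only [h₀, hν₀] at h
    rw [← sub_add_cancel (p v) (ν v), h]
    abel
  refine congrFun (𝒢.derivation_ext φ
    (IsDerivationAlong.sum_mul (fun e => (hD e).isDerivationAlong) a)
    (IsDerivationAlong.inner ι c) ?_ (hι.comp fun y => c * (y - 1)) (fun v x => ?_)
    fun e => ?_) g
  · let _ : TopologicalSpace T := ⊥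
    have : DiscreteTopology T := ⟨rfl⟩
    exact (IsLocallyConstant.iff_continuous _).2 <| continuous_finsetSum _ fun e _ =>
      ((hD e).isLocallyConstant.comp (a e * ·)).continuous
  · have h : ∑ e, a e * D e (𝒢.toGroup φ (𝒢.abstractVertex v x)) =
        p v * (ι (𝒢.toGroup φ (𝒢.abstractVertex v x)) - 1) := by
      simp only [p, Finset.sum_mul, (hD _).vertex, mul_assoc]
    rw [h, hp]
    by_cases hv : v = v₀
    · subst hv
      -- At `v₀` both derivations vanish: the left one since `p v₀ = 0`, the inner one since the
      -- vertex group fixes `c`.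
      rw [hν₀, neg_add_cancel, zero_mul, mul_sub, mul_one, hc, sub_self]
    · rw [hν v hv, zero_add]
  · have h (e') : a e' * D e' (𝒢.toGroup φ (𝒢.abstractLetter e)) =
        a e' * (κ e' (Ξ.d₀ e) * subgroupSum ι (𝒢.edgeImage φ e')) *
          ι (𝒢.toGroup φ (𝒢.abstractLetter e)) -
        a e' * (κ e' (Ξ.d₁ e) * subgroupSum ι (𝒢.edgeImage φ e')) -
        if e' = e then a e * subgroupSum ι (𝒢.edgeImage φ e) else 0 := by
      split_ifs with he
      · subst he
        rw [(hD e').letter_self]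
        noncomm_ring
      · rw [(hD e').letter_of_ne e (Ne.symm he)]
        noncomm_ring
    have h' : ∑ e', a e' * D e' (𝒢.toGroup φ (𝒢.abstractLetter e)) =
        p (Ξ.d₀ e) * ι (𝒢.toGroup φ (𝒢.abstractLetter e)) - p (Ξ.d₁ e) -
          a e * subgroupSum ι (𝒢.edgeImage φ e) := by
      simp only [h, Finset.sum_sub_distrib, ← Finset.sum_mul, p, Finset.sum_ite_eq',
        Finset.mem_univ, if_true]
    rw [h', hp, hp, ha]
    noncomm_ring

/-- Since `P` meets `U` trivially, its conjugate by `t` embeds in the image of `H`, whose sum is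
thus a left multiple of the sum over `t P t⁻¹`. Multiplying on the right by `t` turns that sum into
`t` times the sum over `P`. -/
theorem exists_subgroupSum_mul_eq (R : Type*) [Ring R] (U : OpenNormalSubgroup G)
    (P H : Subgroup G) [Finite P] [Finite (H.map (QuotientGroup.mk' U.toSubgroup))]
    (hP : ∀ x ∈ P, x ∈ U.toSubgroup → x = 1) {t : G} (ht : ∀ x ∈ P, t * x * t⁻¹ ∈ H) :
    ∃ a, subgroupSum (MonoidAlgebra.of R (G ⧸ U.toSubgroup))
      (H.map (QuotientGroup.mk' U.toSubgroup)) * levelHom R U t =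
      a * subgroupSum (levelHom R U) P := by
  let _ := Fintype.ofFinite P
  let j : P →* G ⧸ U.toSubgroup :=
    ((QuotientGroup.mk' U.toSubgroup).comp (MulAut.conj t).toMonoidHom).comp P.subtype
  have hj : Function.Injective j := by
    refine (injective_iff_map_eq_one j).2 fun x hx => Subtype.ext (hP x x.2 ?_)
    have h : t * x * t⁻¹ ∈ U.toSubgroup := (QuotientGroup.eq_one_iff _).1 hx
    have := U.isNormal'.conj_mem _ h t⁻¹
    simpa [mul_assoc] using this
  obtain ⟨a, ha⟩ := exists_subgroupSum_eq_mul (MonoidAlgebra.of R (G ⧸ U.toSubgroup))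
    (H.map (QuotientGroup.mk' U.toSubgroup)) j hj fun x => ⟨_, ht x x.2, rfl⟩
  refine ⟨a * levelHom R U t, ?_⟩
  rw [ha, mul_assoc, mul_assoc, subgroupSum, Finset.mul_sum, Finset.sum_mul]
  refine congrArg (a * ·) (Finset.sum_congr rfl fun x _ => ?_)
  have : MonoidAlgebra.of R (G ⧸ U.toSubgroup) (j x) = levelHom R U (t * x * t⁻¹) := rfl
  rw [this, ← map_mul, ← map_mul, inv_mul_cancel_right]

variable [IsTopologicalGroup G] [CompactSpace G] [TotallyDisconnectedSpace G]

/-- An element killed by the derivations attached to the edges, at all finite levels, lies in the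
vertex group. -/
theorem mem_of_forall_edgeDerivation_eq_zero [Finite E] (R : Type*) [Ring R] [Nontrivial R]
    {H : Subgroup G} (hH : IsClosed (H : Set G)) (hΘ : Ξ.IsSpanningTree Θ) {v₀ : V}
    (hv₀ : ∀ g, g ∈ H ↔ ∃ x, 𝒢.toGroup φ (𝒢.abstractVertex v₀ x) = g) {κ : E → V → ℤ}
    (hκ₀ : ∀ e, κ e v₀ = 0)
    (hκ : ∀ e ∈ Θ, κ e (Ξ.d₀ e) - κ e (Ξ.d₁ e) = 1)
    (hκ' : ∀ e, ∀ e' ∈ Θ, e' ≠ e → κ e (Ξ.d₀ e') - κ e (Ξ.d₁ e') = 0)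
    {D : ∀ (_ : E) (U : OpenNormalSubgroup G), G → MonoidAlgebra R (G ⧸ U.toSubgroup)}
    (hD : ∀ e U, 𝒢.IsEdgeDerivation φ (levelHom R U) (κ e) e (D e U)) {g : G}
    (hg : ∀ e U, D e U g = 0) : g ∈ H := by
  classical
  have := Fintype.ofFinite E
  by_contra hgH
  have hfin : (⋃ e, (𝒢.edgeImage φ e : Set G) \ {1}).Finite :=
    Set.finite_iUnion fun e => (Set.finite_range _).sdiff
  -- A neighbourhood of 1 that separates `g` from `H` and avoids the finitely many nontrivial
  -- elements of the edge images.
  have hopen : IsOpen ((fun x => g * x) ⁻¹' (H : Set G)ᶜ ∩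
      (⋃ e, (𝒢.edgeImage φ e : Set G) \ {1})ᶜ) :=
    (hH.isOpen_compl.preimage (continuous_const_mul g)).inter hfin.isClosed.isOpen_compl
  obtain ⟨U, hU⟩ := ProfiniteGrp.exist_openNormalSubgroup_sub_open_nhds_of_one hopen
    ⟨by simpa using hgH, by simp⟩
  have hUP (e) : ∀ x ∈ 𝒢.edgeImage φ e, x ∈ U.toSubgroup → x = 1 := fun x hx hxU => by
    by_contra hne
    exact (hU hxU).2 (Set.mem_iUnion.2 ⟨e, hx, hne⟩)
  have : Finite (G ⧸ U.toSubgroup) := Subgroup.quotient_finite_of_isOpen _ U.isOpen'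
  let K := H.map (QuotientGroup.mk' U.toSubgroup)
  let c := subgroupSum (MonoidAlgebra.of R (G ⧸ U.toSubgroup)) K
  -- The potential `ν + c` is 0 at `v₀`, as the normalization of `κ` forces, and `c` elsewhere.
  let ν : V → MonoidAlgebra R (G ⧸ U.toSubgroup) := fun v => if v = v₀ then -c else 0
  have ha (e) : ∃ a, a * subgroupSum (levelHom R U) (𝒢.edgeImage φ e) =
      ν (Ξ.d₀ e) * levelHom R U (𝒢.toGroup φ (𝒢.abstractLetter e)) - ν (Ξ.d₁ e) := by
    have h₀ : ∃ a, a * subgroupSum (levelHom R U) (𝒢.edgeImage φ e) =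
        ν (Ξ.d₀ e) * levelHom R U (𝒢.toGroup φ (𝒢.abstractLetter e)) := by
      by_cases h : Ξ.d₀ e = v₀
      · obtain ⟨a, ha⟩ := exists_subgroupSum_mul_eq R U (𝒢.edgeImage φ e) H (hUP e)
          (t := 𝒢.toGroup φ (𝒢.abstractLetter e)) (by
            rintro _ ⟨x, rfl⟩
            subst h
            refine (hv₀ _).2 ⟨𝒢.bd₀ e x, ?_⟩
            simpa [eq_mul_inv_iff_mul_eq] using (𝒢.toGroup_letter_mul φ e x).symm)
        refine ⟨-a, ?_⟩
        rw [neg_mul, ← ha]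
        simp [ν, h, c, K]
      · exact ⟨0, by simp [ν, h]⟩
    have h₁ : ∃ a, a * subgroupSum (levelHom R U) (𝒢.edgeImage φ e) = ν (Ξ.d₁ e) := by
      by_cases h : Ξ.d₁ e = v₀
      · obtain ⟨a, ha⟩ := exists_subgroupSum_mul_eq R U (𝒢.edgeImage φ e) H (hUP e)
          (t := 1) (by
            rintro _ ⟨x, rfl⟩
            subst h
            rw [one_mul, inv_one, mul_one, hv₀]
            exact ⟨_, rfl⟩)
        refine ⟨-a, ?_⟩
        rw [neg_mul, ← ha]
        simp [ν, h, c, K]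
      · exact ⟨0, by simp [ν, h]⟩
    obtain ⟨a₀, h₀⟩ := h₀
    obtain ⟨a₁, h₁⟩ := h₁
    exact ⟨a₀ - a₁, by rw [sub_mul, h₀, h₁]⟩
  choose a ha using ha
  have hmain := sum_mul_edgeDerivation_eq (isLocallyConstant_levelHom R U) hΘ hκ₀ hκ hκ'
    (fun e => hD e U) (c := c) (ν := ν) (by simp [ν]) (fun v hv => by simp [ν, hv])
    (fun x => subgroupSum_mul _ K ⟨_, (hv₀ _).2 ⟨x, rfl⟩, rfl⟩) ha g
  simp only [hg, mul_zero, Finset.sum_const_zero] at hmain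
  obtain ⟨h, hh, hhg⟩ := mem_of_subgroupSum_mul_eq K hmain.symm
  have hmem : g⁻¹ * h ∈ U.toSubgroup := QuotientGroup.eq.1 hhg.symm
  refine (hU hmem).1 ?_
  simpa using hh

end GraphOfProfiniteGroups

/-! ### Passage to the inverse limit and conclusion. -/

namespace CompletedGroupAlgebra

variable (R : Type*) [Ring R] {G : Type*} [Group G] [TopologicalSpace G]

/-- A compatible system of locally constant derivations at the finite levels defines a continuous
right derivation to the completed group algebra. -/
theorem exists_of_compatible {E : Type*}
    {D : ∀ (_ : E) (U : OpenNormalSubgroup G), G → MonoidAlgebra R (G ⧸ U.toSubgroup)}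
    (hc : ∀ e U, IsLocallyConstant (D e U))
    (hD : ∀ e U, IsDerivationAlong (levelHom R U) (D e U))
    (hcomp : ∀ e (U U' : OpenNormalSubgroup G) (h : U.toSubgroup ≤ U'.toSubgroup) g,
      MonoidAlgebra.mapDomainRingHom R
        (QuotientGroup.map U.toSubgroup U'.toSubgroup (MonoidHom.id G) h) (D e U g) = D e U' g) :
    ∃ f : G → E → CompletedGroupAlgebra R G, Continuous f ∧ IsRightDerivation f ∧
      ∀ g, f g = 0 ↔ ∀ e U, D e U g = 0 := by
  let f : G → E → CompletedGroupAlgebra R G :=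
    fun g e => ⟨fun U => D e U g, fun U U' h => hcomp e U U' h g⟩
  refine ⟨f, ?_, fun g h => ?_, fun g => ?_⟩
  · let _ (U : OpenNormalSubgroup G) : TopologicalSpace (MonoidAlgebra R (G ⧸ U.toSubgroup)) := ⊥
    refine continuous_pi fun e => continuous_induced_rng.2 ?_
    exact continuous_pi fun U => (hc e U).continuous
  · exact funext fun e => Subtype.ext (funext fun U => hD e U g h)
  · refine ⟨fun h e U => ?_, fun h => funext fun e => Subtype.ext (funext fun U => h e U)⟩
    exact congrFun (congrArg Subtype.val (congrFun h e)) U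

end CompletedGroupAlgebra

namespace GraphOfProfiniteGroups

variable {V : Type uV} {E : Type uE} [Finite E] {Ξ : OrientedGraph V E}
  {𝒢 : GraphOfProfiniteGroups.{uV, uE, uX, uY} Ξ} [∀ e, Finite (𝒢.edgeGroup e)]
  {G : Type*} [Group G] [TopologicalSpace G] [IsTopologicalGroup G] [CompactSpace G]
  [TotallyDisconnectedSpace G] {Θ : Set E} (φ : 𝒢.FundamentalGroup Θ ≃ₜ* G)

theorem exists_derivation_eq_zero_iff (R : Type*) [Ring R] [Finite R] [Nontrivial R]
    {H : Subgroup G} (hH : IsClosed (H : Set G)) (hΘ : Ξ.IsSpanningTree Θ) {v₀ : V}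
    (hv₀ : ∀ g, g ∈ H ↔ ∃ x, 𝒢.toGroup φ (𝒢.abstractVertex v₀ x) = g) :
    ∃ f : G → E → CompletedGroupAlgebra R G,
      Continuous f ∧ IsRightDerivation f ∧ ∀ g, f g = 0 ↔ g ∈ H := by
  choose κ hκ₀ hκ hκ' using hΘ.exists_potential v₀
  have hex (e) (U : OpenNormalSubgroup G) : ∃ D, 𝒢.IsEdgeDerivation φ (levelHom R U) (κ e) e D :=
    have : Finite (G ⧸ U.toSubgroup) := Subgroup.quotient_finite_of_isOpen _ U.isOpen'
    𝒢.exists_isEdgeDerivation φ (isLocallyConstant_levelHom R U) (hκ e) (hκ' e)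
  choose D hD using hex
  obtain ⟨f, hf, hf', hf₀⟩ := CompletedGroupAlgebra.exists_of_compatible R
    (fun e U => (hD e U).isLocallyConstant) (fun e U => (hD e U).isDerivationAlong)
    fun e U U' h g => by
      -- The image at level `U'` of the derivation at level `U` is again an edge derivation for the
      -- same `κ e`, so uniqueness gives compatibility.
      have hmap := (hD e U).map (MonoidAlgebra.mapDomainRingHom R
        (QuotientGroup.map U.toSubgroup U'.toSubgroup (MonoidHom.id G) h))
      rw [mapDomainRingHom_comp_levelHom] at hmap
      exact congrFun (hmap.eq (hD e U')) g
  refine ⟨f, hf, hf', fun g => (hf₀ g).trans ⟨fun hg => ?_, fun hg e U => ?_⟩⟩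
  · exact mem_of_forall_edgeDerivation_eq_zero R hH hΘ hv₀ hκ₀ hκ hκ' hD hg
  · obtain ⟨x, rfl⟩ := (hv₀ g).1 hg
    rw [(hD e U).vertex, hκ₀]
    simp

end GraphOfProfiniteGroups

theorem theorem1
    {G : Type*} [Group G] [TopologicalSpace G] [IsTopologicalGroup G] [CompactSpace G]
    [TotallyDisconnectedSpace G]
    (H : Subgroup G) (hH : IsClosed (H : Set G))
    {V : Type*} {E : Type*} [Finite V] [Finite E] (n : ℕ) (hn : Nat.card E = n)
    (Ξ : OrientedGraph V E) (𝒢 : GraphOfProfiniteGroups Ξ) (Θ : Set E)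
    (hacc : IsAccessibleVia H 𝒢 Θ)
    (R : Type*) [Ring R] [Finite R]
    (hR : ∀ e : E, (Nat.card (𝒢.edgeGroup e) : R) ≠ 0) :
    ∃ f : G → Fin n → CompletedGroupAlgebra R G,
      Continuous f ∧ IsRightDerivation f ∧ {g : G | f g = 0} = (H : Set G) := by
  have := hacc.finite_edgeGroup
  obtain ⟨φ, v₀, hv₀⟩ := hacc.exists_vertex
  rcases isEmpty_or_nonempty E with hE | ⟨⟨e₀⟩⟩
  · -- without edges `H` is the whole group, which the ring `ℤ/2` suffices to detect
    subst hn
    have : IsEmpty (Fin (Nat.card E)) := by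
      rw [Nat.card_of_isEmpty]
      infer_instance
    obtain ⟨f, -, -, hf⟩ := GraphOfProfiniteGroups.exists_derivation_eq_zero_iff φ (ZMod 2) hH
      hacc.isSpanningTree hv₀
    exact ⟨0, continuous_zero, fun _ _ => Subsingleton.elim _ _, Set.ext fun g =>
      ⟨fun _ => (hf g).1 (Subsingleton.elim _ _), fun _ => rfl⟩⟩
  · have : Nontrivial R := ⟨_, _, hR e₀⟩
    obtain ⟨f, hf, hf', hf₀⟩ := GraphOfProfiniteGroups.exists_derivation_eq_zero_iff φ R hH
      hacc.isSpanningTree hv₀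
    let ε := Finite.equivFinOfCardEq hn
    refine ⟨fun g i => f g (ε.symm i), ?_, fun g h => ?_, Set.ext fun g => ?_⟩
    · exact continuous_pi fun i => (continuous_apply _).comp hf
    · exact funext fun i => congrFun (hf' g h) _
    · refine Iff.trans ⟨fun h => funext fun e => ?_, fun h => ?_⟩ (hf₀ g)
      · simpa using congrFun h (ε e)
      · exact funext fun i => congrFun h _
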